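/- Let $S_1=\{(x,y,0)\in\mathbb{R}^3: x^2+y^2\le 1\}$, $S_2=\{(0,y,z)\in\mathbb{R}^3: y^2+z^2\le 1\}$, $\Sigma=S_1\cap S_2=\{(0,y,0):|y|\le 1\}$ and $\mu=\mathcal{H}^2|_{S_1}+\mathcal{H}^2|_{S_2}$, where $\mathcal{H}^2$ is the two-dimensional Hausdorff measure. For $x\in\mathbb{R}^3$ let $N_\mu(x)$ be the set of values $w(x)$ of the fields $w\in C_c^\infty(\mathbb{R}^3;\mathbb{R}^3)$ for which there is $v\in C_c^\infty(\mathbb{R}^3)$ with $v=0$ and $w=\nabla v$ on $\operatorname{supp}\mu$. Let $T_\mu(x)=\{\xi\in\mathbb{R}^3:\xi\perp N_\mu(x)\}$, let $P_\mu(x)$ be the orthogonal projection of $\mathbb{R}^3$ onto $T_\mu(x)$, and put $\nabla_\mu\varphi(x)=P_\mu(x)\nabla\varphi(x)$ for $\varphi\in C_c^\infty(\mathbb{R}^3)$. Let $H^1_\mu$ be the completion of $C_c^\infty(\mathbb{R}^3)$ with respect to the norm $\left(\|\varphi\|_{L^2_\mu}^2+\|\nabla_\mu\varphi\|_{L^2_\mu}^2\right)^{1/2}$,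 regarded as a space of functions in $L^2_\mu$: $u\in H^1_\mu$ means that $u \in L^2_\mu$ is the $L^2_\mu$-limit of a sequence $\varphi_n\in C_c^\infty(\mathbb{R}^3)$ whose tangent gradients $\nabla_\mu\varphi_n$ converge in $L^2_\mu$. For $i=1,2$ let $H^1(S_i)$ be the classical Sobolev space of the disc $S_i$ (functions in $L^2$ of the open disc with weak gradient in $L^2$). For $f\in H^1(S_i)$ let $\operatorname{tr}^\Sigma f\in L^2(\Sigma)$ be the usual trace: the limit in $L^2(\Sigma)$ of $\alpha_n|_\Sigma$ for functions $\alpha_n$, smooth up to the boundary of $S_i$, that converge to $f$ in $H^1(S_i)$. Let $u\in H^1_\mu$. Then the restrictions $u_i=u|_{S_i}$ belong to $H^1(S_i)$ for $i=1,2$, their traces on $\Sigma$ exist and are uniquely determined as elements of $L^2(\Sigma)$, and $$\operatorname{tr}^\Sigma u_1=\operatorname{tr}^\Sigma u_2 \quad\text{in } L^2(\Sigma).$$ -/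

import Mathlib

open MeasureTheory Filter Topology Set
open scoped ContDiff Gradient ENNReal

namespace TwoDiscs

/-- The Euclidean plane. -/
abbrev E2 : Type := EuclideanSpace ℝ (Fin 2)

/-- Euclidean three-space. -/
abbrev E3 : Type := EuclideanSpace ℝ (Fin 3)

section MeasureSobolev

/-- `C_c^∞(ℝ³)`: smooth functions with compact support. -/
def IsTest3 (v : E3 → ℝ) : Prop :=
  ContDiff ℝ ∞ v ∧ HasCompactSupport v

/-- The test functions that vanish on the support of `μ`. -/
def vanishing (μ : Measure E3) : Set (E3 → ℝ) :=
  {v | IsTest3 v ∧ ∀ x ∈ μ.support, v x = 0}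

/-- The smooth compactly supported vector fields that coincide on the support of `μ` with the
gradient of a test function vanishing on the support of `μ`. -/
noncomputable def normalFields (μ : Measure E3) : Set (E3 → E3) :=
  {w | ContDiff ℝ ∞ w ∧ HasCompactSupport w ∧
    ∃ v ∈ vanishing μ, ∀ x ∈ μ.support, w x = ∇ v x}

/-- The set `N_μ(x)` of values at `x` of those vector fields. -/
noncomputable def normalSet (μ : Measure E3) (x : E3) : Set E3 :=
  {ξ | ∃ w ∈ normalFields μ, w x = ξ}

/-- The tangent space `T_μ(x)`: all vectors orthogonal to `N_μ(x)`. -/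
noncomputable def tangentSpace (μ : Measure E3) (x : E3) : Submodule ℝ E3 :=
  (Submodule.span ℝ (normalSet μ x))ᗮ

/-- The tangent gradient `∇_μ φ (x) = P_μ(x) ∇φ(x)`, with `P_μ(x)` the orthogonal projection
of `ℝ³` onto `T_μ(x)`. -/
noncomputable def tangentGradient (μ : Measure E3) (φ : E3 → ℝ) (x : E3) : E3 :=
  (tangentSpace μ x).starProjection (∇ φ x)

/-- `u ∈ H¹_μ`, the completion of `C_c^∞(ℝ³)` for the norm
`(‖φ‖²_{L²_μ} + ‖∇_μ φ‖²_{L²_μ})^{1/2}`, realised inside `L²_μ`: some sequence of test functions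
converges to `u` in `L²_μ` while its tangent gradients converge in `L²_μ(ℝ³; ℝ³)`. -/
def MemH1mu (μ : Measure E3) (u : E3 → ℝ) : Prop :=
  MemLp u 2 μ ∧ ∃ G : E3 → E3, MemLp G 2 μ ∧ ∃ φ : ℕ → E3 → ℝ,
    (∀ n, IsTest3 (φ n)) ∧
    Tendsto (fun n => eLpNorm (fun x => φ n x - u x) 2 μ) atTop (𝓝 0) ∧
    Tendsto (fun n => eLpNorm (fun x => tangentGradient μ (φ n) x - G x) 2 μ) atTop (𝓝 0)

end MeasureSobolev

section Model

/-- The horizontal disc `{(x, y, 0) : x² + y² ≤ 1}`. -/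
def S1 : Set E3 := {p | p 0 ^ 2 + p 1 ^ 2 ≤ 1 ∧ p 2 = 0}

/-- The vertical disc `{(0, y, z) : y² + z² ≤ 1}`. -/
def S2 : Set E3 := {p | p 0 = 0 ∧ p 1 ^ 2 + p 2 ^ 2 ≤ 1}

/-- `μ = ℋ²⌞S₁ + ℋ²⌞S₂`, with the Hausdorff measure normalised to agree with area on planes. -/
noncomputable def mu : Measure E3 :=
  (Measure.euclideanHausdorffMeasure 2).restrict S1 +
    (Measure.euclideanHausdorffMeasure 2).restrict S2

/-- The isometric coordinates `(s, y) ↦ (s, y, 0)` on `S₁`. -/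
noncomputable def chart1 (p : E2) : E3 := !₂[p 0, p 1, 0]

/-- The isometric coordinates `(s, y) ↦ (0, y, s)` on `S₂`. -/
noncomputable def chart2 (p : E2) : E3 := !₂[0, p 1, p 0]

/-- The restriction `u₁ = u|_{S₁}`, written in the coordinates `(s, y)`. -/
noncomputable def restr1 (u : E3 → ℝ) : E2 → ℝ := fun p => u (chart1 p)

/-- The restriction `u₂ = u|_{S₂}`, written in the coordinates `(s, y)`. -/
noncomputable def restr2 (u : E3 → ℝ) : E2 → ℝ := fun p => u (chart2 p)

end Model

section Disc

/-- The open unit disc of the plane. -/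
def disc : Set E2 := Metric.ball 0 1

/-- `G` is the weak gradient of `f` on the unit disc. -/
def IsWeakGradient (f : E2 → ℝ) (G : E2 → E2) : Prop :=
  ∀ φ : E2 → ℝ, ContDiff ℝ ∞ φ → HasCompactSupport φ → tsupport φ ⊆ disc → ∀ v : E2,
    ∫ x in disc, f x * fderiv ℝ φ x v = - ∫ x in disc, inner ℝ (G x) v * φ x

/-- `f` lies in the classical Sobolev space `H¹` of the unit disc, with weak gradient `G`. -/
def HasH1Gradient (f : E2 → ℝ) (G : E2 → E2) : Prop :=
  MemLp f 2 (volume.restrict disc) ∧ MemLp G 2 (volume.restrict disc) ∧ IsWeakGradient f G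

/-- The classical Sobolev space `H¹` of the unit disc. -/
def MemH1 (f : E2 → ℝ) : Prop := ∃ G : E2 → E2, HasH1Gradient f G

/-- `g`, a function of `y ∈ (-1, 1)`, is the trace of `f ∈ H¹(disc)` on the diameter
`{(0, y) : |y| ≤ 1}`. This is the graph of the usual trace operator `H¹ → L²`, the continuous
extension of `α ↦ α(0, ·)` from functions smooth up to the boundary: `f` is the `H¹`-limit of
smooth functions whose restrictions to the diameter converge to `g` in `L²`. -/
def IsTrace (f : E2 → ℝ) (g : ℝ → ℝ) : Prop :=
  MemLp g 2 (volume.restrict (Ioo (-1 : ℝ) 1)) ∧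
  ∃ G : E2 → E2, HasH1Gradient f G ∧ ∃ α : ℕ → E2 → ℝ,
    (∀ n, ContDiff ℝ ∞ (α n)) ∧
    Tendsto (fun n => eLpNorm (fun x => α n x - f x) 2 (volume.restrict disc)) atTop (𝓝 0) ∧
    Tendsto (fun n => eLpNorm (fun x => ∇ (α n) x - G x) 2 (volume.restrict disc))
      atTop (𝓝 0) ∧
    Tendsto (fun n => eLpNorm (fun y : ℝ => α n !₂[0, y] - g y) 2
      (volume.restrict (Ioo (-1 : ℝ) 1))) atTop (𝓝 0)

end Disc

end TwoDiscs

/-!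
Pull back the test functions `φ n` that approximate `u` in `H¹_μ` along the two isometric charts.
A test function that vanishes on the support of `μ` vanishes on each disc, hence has zero derivative
along it; so at every point of an open disc the tangent space contains the plane of that disc
(`map_mem_tangentSpace`), and the planar gradient of `φ n ∘ c` is the image of the tangent gradient
under the adjoint of the chart `c` (`adjoint_tangentGradient`). As `μ` dominates the pushforward
of the area of the open disc (`map_disc_le`), convergence in `H¹_μ` implies that the pulled-back
functions converge in `H¹` of each disc (`smoothApprox_of_tendsto`), whose limit has the limit of
the gradients as weak gradient (`SmoothApprox.hasH1Gradient`).

The trace inequality (`eLpNorm_trace_le`) comes from integrating along the segments that join the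
points `(0, y)` of the diameter to `(1, 0)`: they stay in the disc up to `y = ±1`, and on their first
half the change of variables `(t, y) ↦ (t, (1 - t) y)` has Jacobian at least `1/2`. With
completeness of `L²` it gives the existence of traces (`SmoothApprox.exists_trace`), and with
uniqueness of weak gradients (`HasH1Gradient.ae_eq`) their independence of the approximating
sequence (`SmoothApprox.isTrace_iff`). Finally `chart1 (0, y) = chart2 (0, y)`, so the pullbacks of
each `φ n` to the two discs have the same restriction to the diameter, and the limits agree.
-/

namespace TwoDiscs

/-! ### The trace inequality on the diameter -/

section TraceInequality

/-- Integrate the derivative of `(2t - 1) f(t)²`, a function that equals `-f(0)²` at `t = 0` and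
vanishes at `t = 1/2`. -/
theorem sq_apply_zero_le_integral {f : ℝ → ℝ} (hf : ContDiff ℝ 1 f) :
    f 0 ^ 2 ≤ ∫ t in (0 : ℝ)..(1 / 2), (3 * f t ^ 2 + deriv f t ^ 2) := by
  have hd : ∀ t, HasDerivAt f (deriv f t) t := fun t =>
    (hf.differentiable one_ne_zero t).hasDerivAt
  have hc : Continuous f := hf.continuous
  have hc' : Continuous (deriv f) := hf.continuous_deriv le_rfl
  have hF : ∀ t ∈ uIcc (0 : ℝ) (1 / 2), HasDerivAt (fun t => (2 * t - 1) * f t ^ 2)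
      (2 * f t ^ 2 + (2 * t - 1) * (2 * f t * deriv f t)) t := by
    intro t _
    have h1 : HasDerivAt (fun t : ℝ => 2 * t - 1) 2 t := by
      simpa using ((hasDerivAt_id t).const_mul 2).sub_const 1
    have h2 := (hd t).pow 2
    convert! h1.mul h2 using 1
    simp only [Pi.pow_apply]
    push_cast
    ring
  have key := intervalIntegral.integral_eq_sub_of_hasDerivAt hF
    (Continuous.intervalIntegrable (by fun_prop) _ _)
  have h0 : f 0 ^ 2 = ∫ t in (0 : ℝ)..(1 / 2),
      (2 * f t ^ 2 + (2 * t - 1) * (2 * f t * deriv f t)) := by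
    rw [key]; norm_num
  rw [h0]
  refine intervalIntegral.integral_mono_on (by norm_num)
    (Continuous.intervalIntegrable (by fun_prop) _ _)
    (Continuous.intervalIntegrable (by fun_prop) _ _) fun t ht => ?_
  have h1 : (2 * t - 1) ^ 2 ≤ 1 := by nlinarith [ht.1, ht.2]
  nlinarith [sq_nonneg ((2 * t - 1) * f t - deriv f t),
    mul_le_mul_of_nonneg_right h1 (sq_nonneg (f t))]

theorem contDiff_vec2 {a b : ℝ → ℝ} (ha : ContDiff ℝ ∞ a) (hb : ContDiff ℝ ∞ b) :
    ContDiff ℝ ∞ (fun t => (!₂[a t, b t] : E2)) := by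
  rw [contDiff_euclidean]
  intro i
  fin_cases i <;> simpa

/-- Along the segment from `(0, y)` to `(1, 0)` the speed is at most `√2`. -/
theorem sq_deriv_along_segment_le {α : E2 → ℝ} (hα : ContDiff ℝ ∞ α) {y : ℝ}
    (hy : y ∈ Ioo (-1 : ℝ) 1) (t : ℝ) :
    deriv (fun t => α !₂[t, (1 - t) * y]) t ^ 2 ≤ 2 * ‖∇ α !₂[t, (1 - t) * y]‖ ^ 2 := by
  have hs : HasDerivAt (fun t : ℝ => (!₂[t, (1 - t) * y] : E2)) !₂[1, -y] t := by
    have e : (fun t : ℝ => (!₂[t, (1 - t) * y] : E2)) =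
        fun t => !₂[0, y] + id t • (!₂[1, -y] : E2) := by
      funext s
      refine PiLp.ext fun i => ?_
      fin_cases i
      · simp
      · simp
        ring
    rw [e]
    simpa only [one_smul] using
      ((hasDerivAt_id t).smul_const (!₂[1, -y] : E2)).const_add !₂[0, y]
  have hg := ((hα.differentiable (by simp)) (!₂[t, (1 - t) * y] : E2)).hasGradientAt
  have h := hg.hasFDerivAt.comp_hasDerivAt t hs
  rw [show (fun t => α !₂[t, (1 - t) * y]) = α ∘ fun t => !₂[t, (1 - t) * y] from rfl, h.deriv,
    InnerProductSpace.toDual_apply_apply]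
  have h1 := abs_real_inner_le_norm (∇ α !₂[t, (1 - t) * y]) (!₂[1, -y] : E2)
  have h2 : ‖(!₂[1, -y] : E2)‖ ^ 2 ≤ 2 := by
    rw [EuclideanSpace.norm_sq_eq]
    simp only [Fin.sum_univ_two]
    simp only [Matrix.cons_val_zero, Matrix.cons_val_one, Real.norm_eq_abs, sq_abs]
    nlinarith [hy.1, hy.2]
  calc _ = |inner ℝ (∇ α !₂[t, (1 - t) * y]) (!₂[1, -y] : E2)| ^ 2 := (sq_abs _).symm
    _ ≤ (‖∇ α !₂[t, (1 - t) * y]‖ * ‖(!₂[1, -y] : E2)‖) ^ 2 := by gcongr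
    _ = ‖(!₂[1, -y] : E2)‖ ^ 2 * ‖∇ α !₂[t, (1 - t) * y]‖ ^ 2 := by ring
    _ ≤ _ := by gcongr

/-- The segments from the points of the diameter to `(1, 0)` stay inside the disc. Horizontal
segments would not do: the room they have shrinks to zero as `y → ±1`. -/
theorem segment_mem_disc {y t : ℝ} (hy : y ∈ Ioo (-1 : ℝ) 1) (ht : t ∈ Ioo (0 : ℝ) (1 / 2)) :
    (!₂[t, (1 - t) * y] : E2) ∈ disc := by
  rw [disc, mem_ball_zero_iff, ← sq_lt_one_iff₀ (norm_nonneg _), EuclideanSpace.norm_sq_eq]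
  simp only [Fin.sum_univ_two]
  simp only [Matrix.cons_val_zero, Matrix.cons_val_one, Real.norm_eq_abs, sq_abs]
  have h1 : y ^ 2 ≤ 1 := by nlinarith [hy.1, hy.2]
  nlinarith [ht.1, ht.2, mul_le_mul_of_nonneg_left h1 (sq_nonneg (1 - t))]

theorem lintegral_E2_eq {H : E2 → ℝ≥0∞} (hH : Measurable H) :
    ∫⁻ p, H p = ∫⁻ t : ℝ, ∫⁻ z : ℝ, H !₂[t, z] := by
  have e1 := (EuclideanSpace.volume_preserving_symm_measurableEquiv_toLp (Fin 2)).symm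
  have e2 := (volume_preserving_finTwoArrow ℝ).symm
  have e := e1.comp e2
  rw [← e.lintegral_comp hH]
  rw [Measure.volume_eq_prod, lintegral_prod (fun q => H _) (hH.comp e.measurable).aemeasurable]
  rfl

/-- The map `(t, y) ↦ (t, (1 - t) y)` has Jacobian `1 - t ≥ 1/2` for `t < 1/2`, whence the factor `2`. -/
theorem lintegral_scaled_slices_le {H : E2 → ℝ≥0∞} (hH : Measurable H) :
    ∫⁻ t in Ioo (0 : ℝ) (1 / 2), ∫⁻ y : ℝ, H !₂[t, (1 - t) * y] ≤ 2 * ∫⁻ p, H p := by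
  have hm : Measurable fun q : ℝ × ℝ => (!₂[q.1, q.2] : E2) := by fun_prop
  have hmH : Measurable fun t : ℝ => ∫⁻ z : ℝ, H !₂[t, z] :=
    (hH.comp hm).lintegral_prod_right'
  rw [lintegral_E2_eq hH, ← lintegral_const_mul _ hmH]
  refine le_trans (setLIntegral_mono' measurableSet_Ioo fun t ht => ?_) (setLIntegral_le_lintegral _ _)
  have h0 : (1 - t : ℝ) ≠ 0 := by linarith [ht.2]
  have hms : Measurable fun z : ℝ => H !₂[t, z] := hH.comp (hm.comp measurable_prodMk_left)
  have h1 := Real.map_volume_mul_left h0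
  calc ∫⁻ y : ℝ, H !₂[t, (1 - t) * y]
      = ∫⁻ z, H !₂[t, z] ∂(Measure.map ((1 - t) * ·) volume) :=
        (lintegral_map hms (measurable_const_mul _)).symm
    _ = ENNReal.ofReal |(1 - t)⁻¹| * ∫⁻ z : ℝ, H !₂[t, z] := by
        rw [h1, lintegral_smul_measure, smul_eq_mul]
    _ ≤ 2 * ∫⁻ z : ℝ, H !₂[t, z] := by
        gcongr
        rw [show (2 : ℝ≥0∞) = ENNReal.ofReal 2 by simp]
        apply ENNReal.ofReal_le_ofReal
        have : 0 < 1 - t := by linarith [ht.2]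
        rw [abs_of_pos (by positivity), inv_le_comm₀ this (by norm_num)]
        linarith [ht.2]

theorem continuous_gradient {α : E2 → ℝ} (hα : ContDiff ℝ ∞ α) : Continuous (∇ α) :=
  (InnerProductSpace.toDual ℝ E2).symm.continuous.comp (hα.continuous_fderiv (by simp))

theorem lintegral_enorm_sq {X E : Type*} [MeasurableSpace X] [NormedAddCommGroup E] {ν : Measure X}
    (f : X → E) : ∫⁻ x, ‖f x‖ₑ ^ 2 ∂ν = eLpNorm f 2 ν ^ 2 := by
  have := eLpNorm_nnreal_pow_eq_lintegral (μ := ν) (f := f) (p := 2) (by norm_num)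
  simpa using this.symm

theorem eLpNorm_trace_sq_le {α : E2 → ℝ} (hα : ContDiff ℝ ∞ α) :
    eLpNorm (fun y : ℝ => α !₂[0, y]) 2 (volume.restrict (Ioo (-1 : ℝ) 1)) ^ 2 ≤
      6 * eLpNorm α 2 (volume.restrict disc) ^ 2 +
        4 * eLpNorm (∇ α) 2 (volume.restrict disc) ^ 2 := by
  set F : E2 → ℝ≥0∞ := fun p => 3 * ‖α p‖ₑ ^ 2 + 2 * ‖∇ α p‖ₑ ^ 2 with hF
  have hcα : Continuous α := hα.continuous
  have hcg := continuous_gradient hα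
  have hmF : Measurable F := by
    have := hcα.measurable
    have := hcg.measurable
    fun_prop
  have hd : MeasurableSet disc := Metric.isOpen_ball.measurableSet
  have hmH : Measurable (disc.indicator F) := hmF.indicator hd
  have hslice : ∀ y ∈ Ioo (-1 : ℝ) 1, ‖α !₂[0, y]‖ₑ ^ 2 ≤
      ∫⁻ t in Ioo (0 : ℝ) (1 / 2), disc.indicator F !₂[t, (1 - t) * y] := by
    intro y hy
    set f : ℝ → ℝ := fun t => α !₂[t, (1 - t) * y] with hf
    have hfs : ContDiff ℝ ∞ f := hα.comp (contDiff_vec2 contDiff_id (by fun_prop))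
    have hf1 : ContDiff ℝ 1 f := hfs.of_le (by norm_cast)
    have hfc : Continuous f := hf1.continuous
    have hfd : Continuous (deriv f) := hf1.continuous_deriv le_rfl
    have h1 := sq_apply_zero_le_integral hf1
    have e0 : f 0 = α !₂[0, y] := by simp [hf]
    calc ‖α !₂[0, y]‖ₑ ^ 2 = ENNReal.ofReal (f 0 ^ 2) := by
          rw [e0, ← sq_abs, ENNReal.ofReal_pow (abs_nonneg _), ← Real.norm_eq_abs, ofReal_norm]
      _ ≤ ENNReal.ofReal (∫ t in (0 : ℝ)..(1 / 2), (3 * f t ^ 2 + deriv f t ^ 2)) :=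
          ENNReal.ofReal_le_ofReal h1
      _ = ∫⁻ t in Ioo (0 : ℝ) (1 / 2), ENNReal.ofReal (3 * f t ^ 2 + deriv f t ^ 2) := by
          rw [intervalIntegral.integral_of_le (by norm_num), ofReal_integral_eq_lintegral_ofReal,
            restrict_Ioo_eq_restrict_Ioc]
          · exact (Continuous.integrableOn_Icc (by fun_prop)).mono_set Ioc_subset_Icc_self
          · exact ae_of_all _ fun t => by positivity
      _ ≤ _ := by
          refine setLIntegral_mono' measurableSet_Ioo fun t ht => ?_
          rw [indicator_of_mem (segment_mem_disc hy ht)]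
          have h2 := sq_deriv_along_segment_le hα hy t
          calc ENNReal.ofReal (3 * f t ^ 2 + deriv f t ^ 2)
              ≤ ENNReal.ofReal (3 * ‖f t‖ ^ 2 + 2 * ‖∇ α !₂[t, (1 - t) * y]‖ ^ 2) := by
                apply ENNReal.ofReal_le_ofReal
                rw [Real.norm_eq_abs, sq_abs]
                linarith
            _ = _ := by
                rw [ENNReal.ofReal_add (by positivity) (by positivity),
                  ENNReal.ofReal_mul (by norm_num), ENNReal.ofReal_mul (by norm_num),
                  ENNReal.ofReal_pow (norm_nonneg _), ENNReal.ofReal_pow (norm_nonneg _),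
                  ofReal_norm, ofReal_norm]
                simp [hF, hf]
  have hmv : Measurable fun q : ℝ × ℝ => (!₂[q.2, (1 - q.2) * q.1] : E2) := by fun_prop
  calc _ = ∫⁻ y in Ioo (-1 : ℝ) 1, ‖α !₂[0, y]‖ₑ ^ 2 := (lintegral_enorm_sq _).symm
    _ ≤ ∫⁻ y in Ioo (-1 : ℝ) 1, ∫⁻ t in Ioo (0 : ℝ) (1 / 2),
          disc.indicator F !₂[t, (1 - t) * y] := setLIntegral_mono' measurableSet_Ioo hslice
    _ ≤ ∫⁻ y : ℝ, ∫⁻ t in Ioo (0 : ℝ) (1 / 2), disc.indicator F !₂[t, (1 - t) * y] :=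
        setLIntegral_le_lintegral _ _
    _ = ∫⁻ t in Ioo (0 : ℝ) (1 / 2), ∫⁻ y : ℝ, disc.indicator F !₂[t, (1 - t) * y] :=
        lintegral_lintegral_swap (hmH.comp hmv).aemeasurable
    _ ≤ 2 * ∫⁻ p, disc.indicator F p := lintegral_scaled_slices_le hmH
    _ = 2 * (3 * (∫⁻ p in disc, ‖α p‖ₑ ^ 2) + 2 * ∫⁻ p in disc, ‖∇ α p‖ₑ ^ 2) := by
        have m1 : Measurable fun p => ‖α p‖ₑ ^ 2 := by
          have := hcα.measurable
          fun_prop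
        have m2 : Measurable fun p => ‖∇ α p‖ₑ ^ 2 := by
          have := hcg.measurable
          fun_prop
        rw [lintegral_indicator hd, hF, lintegral_add_left (m1.const_mul _),
          lintegral_const_mul _ m1, lintegral_const_mul _ m2]
    _ = _ := by
        rw [lintegral_enorm_sq, lintegral_enorm_sq]
        ring

/-- The trace inequality: on smooth functions, restriction to the diameter is bounded from the `H¹`
norm of the disc to `L²(-1, 1)`. -/
theorem eLpNorm_trace_le {α : E2 → ℝ} (hα : ContDiff ℝ ∞ α) :
    eLpNorm (fun y : ℝ => α !₂[0, y]) 2 (volume.restrict (Ioo (-1 : ℝ) 1)) ≤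
      3 * eLpNorm α 2 (volume.restrict disc) + 2 * eLpNorm (∇ α) 2 (volume.restrict disc) := by
  rw [← ENNReal.pow_le_pow_left_iff two_ne_zero]
  refine (eLpNorm_trace_sq_le hα).trans ?_
  generalize eLpNorm α 2 (volume.restrict disc) = a
  generalize eLpNorm (∇ α) 2 (volume.restrict disc) = b
  calc 6 * a ^ 2 + 4 * b ^ 2 ≤ (6 * a ^ 2 + 4 * b ^ 2) + (3 * a ^ 2 + 12 * a * b) := le_self_add
    _ = (3 * a + 2 * b) ^ 2 := by ring

end TraceInequality

/-! ### Weak gradients and smooth approximation on the disc -/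

section WeakGradient

theorem memLp_restrict_of_continuous {X E : Type*} [TopologicalSpace X] [MeasurableSpace X]
    [OpensMeasurableSpace X] [SecondCountableTopology X] [NormedAddCommGroup E]
    {ν : Measure X} [IsFiniteMeasureOnCompacts ν] {s K : Set X} (hK : IsCompact K) (hs : s ⊆ K)
    (hKm : MeasurableSet K)
    {f : X → E} (hf : Continuous f) (hfm : AEStronglyMeasurable f ν) (p : ℝ≥0∞) :
    MemLp f p (ν.restrict s) := by
  obtain ⟨C, hC⟩ := hK.exists_bound_of_continuousOn hf.continuousOn
  have : IsFiniteMeasure (ν.restrict K) := ⟨by simpa using hK.measure_lt_top⟩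
  exact (MemLp.of_bound (μ := ν.restrict K) hfm.restrict C
    ((ae_restrict_iff' hKm).2 (ae_of_all _ hC))).mono_measure (Measure.restrict_mono hs le_rfl)

theorem memLp_disc_of_continuous {E : Type*} [NormedAddCommGroup E] [SecondCountableTopology E]
    {f : E2 → E} (hf : Continuous f) (p : ℝ≥0∞) : MemLp f p (volume.restrict disc) := by
  borelize E
  exact memLp_restrict_of_continuous (isCompact_closedBall (0 : E2) 1) Metric.ball_subset_closedBall
    Metric.isClosed_closedBall.measurableSet hf hf.aestronglyMeasurable p

theorem tendsto_integral_mul_of_tendsto_L2 {X : Type*} [MeasurableSpace X] {ν : Measure X}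
    {a : ℕ → X → ℝ} {f h : X → ℝ} (ha : ∀ n, MemLp (a n) 2 ν) (hf : MemLp f 2 ν)
    (hh : MemLp h 2 ν) (hl : Tendsto (fun n => eLpNorm (fun x => a n x - f x) 2 ν) atTop (𝓝 0)) :
    Tendsto (fun n => ∫ x, a n x * h x ∂ν) atTop (𝓝 (∫ x, f x * h x ∂ν)) := by
  refine tendsto_integral_of_L1' _ (hf.integrable_mul hh).aestronglyMeasurable
    (Eventually.of_forall fun n => (ha n).integrable_mul hh) ?_
  have hb : Tendsto (fun n => eLpNorm (fun x => a n x - f x) 2 ν * eLpNorm h 2 ν) atTop (𝓝 0) := by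
    simpa using ENNReal.Tendsto.mul_const hl (Or.inr hh.eLpNorm_ne_top)
  refine tendsto_of_tendsto_of_tendsto_of_le_of_le tendsto_const_nhds hb (fun _ => zero_le) fun n => ?_
  have := eLpNorm_smul_le_mul_eLpNorm (p := 2) (q := 2) (r := 1) hh.1 ((ha n).sub hf).1
  refine le_trans (le_of_eq ?_) this
  congr 1
  funext x
  simp [sub_mul]

theorem isWeakGradient_of_contDiff {α : E2 → ℝ} (hα : ContDiff ℝ ∞ α) :
    IsWeakGradient α (∇ α) := by
  intro φ hφ hφc hφs v
  have hdα : Continuous (fderiv ℝ α) := hα.continuous_fderiv (by simp)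
  have hdφ : Continuous (fderiv ℝ φ) := hφ.continuous_fderiv (by simp)
  have hcα := hα.continuous
  have hcφ := hφ.continuous
  simp only [inner_gradient_left]
  have hφ0 : ∀ x, x ∉ disc → φ x = 0 := fun x hx => image_eq_zero_of_notMem_tsupport fun h => hx (hφs h)
  have hφd0 : ∀ x, x ∉ disc → fderiv ℝ φ x = 0 := fun x hx =>
    image_eq_zero_of_notMem_tsupport fun h => hx (hφs (tsupport_fderiv_subset ℝ h))
  rw [setIntegral_eq_integral_of_forall_compl_eq_zero fun x hx => by simp [hφd0 x hx],
    setIntegral_eq_integral_of_forall_compl_eq_zero fun x hx => by simp [hφ0 x hx]]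
  refine integral_mul_fderiv_eq_neg_fderiv_mul_of_integrable ?_ ?_ ?_
    (fun x _ => hα.differentiable (by simp) x) (fun x _ => hφ.differentiable (by simp) x)
  · exact Continuous.integrable_of_hasCompactSupport (by fun_prop) (hφc.mul_left)
  · exact Continuous.integrable_of_hasCompactSupport (by fun_prop)
      ((hφc.fderiv_apply ℝ v).mul_left)
  · exact Continuous.integrable_of_hasCompactSupport (by fun_prop) (hφc.mul_left)

/-- `α n` is a sequence of smooth functions on the plane with `α n → f` and `∇ (α n) → G` in `L²`
of the unit disc. -/
structure SmoothApprox (α : ℕ → E2 → ℝ) (f : E2 → ℝ) (G : E2 → E2) : Prop where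
  contDiff : ∀ n, ContDiff ℝ ∞ (α n)
  tendsto : Tendsto (fun n => eLpNorm (fun x => α n x - f x) 2 (volume.restrict disc)) atTop (𝓝 0)
  tendsto_gradient :
    Tendsto (fun n => eLpNorm (fun x => ∇ (α n) x - G x) 2 (volume.restrict disc)) atTop (𝓝 0)

theorem SmoothApprox.hasH1Gradient {α : ℕ → E2 → ℝ} {f : E2 → ℝ} {G : E2 → E2}
    (h : SmoothApprox α f G) (hf : MemLp f 2 (volume.restrict disc))
    (hG : MemLp G 2 (volume.restrict disc)) : HasH1Gradient f G := by
  refine ⟨hf, hG, fun φ hφ hφc hφs v => ?_⟩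
  have hdφ : Continuous (fderiv ℝ φ) := hφ.continuous_fderiv (by simp)
  have hcφ := hφ.continuous
  have l1 := tendsto_integral_mul_of_tendsto_L2
    (fun n => memLp_disc_of_continuous (h.contDiff n).continuous 2) hf
    (memLp_disc_of_continuous (f := fun x => fderiv ℝ φ x v) (by fun_prop) 2) h.tendsto
  have hin : ∀ n, MemLp (fun x => inner ℝ (∇ (α n) x) v) 2 (volume.restrict disc) := fun n =>
    memLp_disc_of_continuous ((continuous_gradient (h.contDiff n)).inner continuous_const) 2
  have hGv : MemLp (fun x => inner ℝ (G x) v) 2 (volume.restrict disc) := hG.inner_const v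
  have l2 := tendsto_integral_mul_of_tendsto_L2 hin hGv (memLp_disc_of_continuous hcφ 2) (by
    have hb := ENNReal.Tendsto.const_mul (a := ENNReal.ofReal ‖v‖) h.tendsto_gradient
      (Or.inr ENNReal.ofReal_ne_top)
    rw [mul_zero] at hb
    refine tendsto_of_tendsto_of_tendsto_of_le_of_le tendsto_const_nhds hb (fun _ => zero_le)
      fun n => eLpNorm_le_mul_eLpNorm_of_ae_le_mul (ae_of_all _ fun x => ?_) 2
    rw [← inner_sub_left, mul_comm]
    exact norm_inner_le_norm _ _)
  refine tendsto_nhds_unique l1 (l2.neg.congr fun n => ?_)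
  exact (isWeakGradient_of_contDiff (h.contDiff n) φ hφ hφc hφs v).symm

theorem isFiniteMeasure_disc : IsFiniteMeasure (volume.restrict disc) :=
  ⟨by simp [disc]⟩

/-- Uniqueness of the weak gradient. -/
theorem HasH1Gradient.ae_eq {f : E2 → ℝ} {G G' : E2 → E2} (h : HasH1Gradient f G)
    (h' : HasH1Gradient f G') : G =ᵐ[volume.restrict disc] G' := by
  have := isFiniteMeasure_disc
  have hd : IsOpen disc := Metric.isOpen_ball
  have hGi : IntegrableOn G disc volume := h.2.1.integrable one_le_two
  have hGi' : IntegrableOn G' disc volume := h'.2.1.integrable one_le_two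
  have key := hd.ae_eq_zero_of_integral_contDiff_smul_eq_zero (f := fun x => G x - G' x)
    (μ := volume) (hGi.sub hGi').locallyIntegrableOn fun φ hφ hφc hφs => by
    have hφ0 : ∀ x, x ∉ disc → φ x = 0 := fun x hx =>
      image_eq_zero_of_notMem_tsupport fun h => hx (hφs h)
    rw [← setIntegral_eq_integral_of_forall_compl_eq_zero (s := disc)
      fun x hx => by simp [hφ0 x hx]]
    have hb : MemLp φ ∞ (volume.restrict disc) := memLp_disc_of_continuous hφ.continuous _
    have i1 : Integrable (fun x => φ x • G x) (volume.restrict disc) := hGi.smul_of_top_right hb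
    have i2 : Integrable (fun x => φ x • G' x) (volume.restrict disc) := hGi'.smul_of_top_right hb
    simp only [smul_sub]
    rw [integral_sub i1 i2, sub_eq_zero]
    refine ext_inner_left ℝ fun v => ?_
    rw [← integral_inner i1, ← integral_inner i2]
    have e := (h.2.2 φ hφ hφc hφs v).symm.trans (h'.2.2 φ hφ hφc hφs v)
    simpa only [inner_smul_right, real_inner_comm v, mul_comm (φ _)] using neg_injective e
  filter_upwards [(ae_restrict_iff' hd.measurableSet).2 key] with x hx using sub_eq_zero.1 hx

end WeakGradient

/-! ### Existence and uniqueness of the trace -/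

section Trace

theorem tendsto_eLpNorm_trace {ι : Type*} {l : Filter ι} {α : ι → E2 → ℝ}
    (hα : ∀ i, ContDiff ℝ ∞ (α i))
    (h0 : Tendsto (fun i => eLpNorm (α i) 2 (volume.restrict disc)) l (𝓝 0))
    (h1 : Tendsto (fun i => eLpNorm (∇ (α i)) 2 (volume.restrict disc)) l (𝓝 0)) :
    Tendsto (fun i => eLpNorm (fun y : ℝ => α i !₂[0, y]) 2 (volume.restrict (Ioo (-1 : ℝ) 1)))
      l (𝓝 0) := by
  have hb := (ENNReal.Tendsto.const_mul h0 (Or.inr (by finiteness : (3 : ℝ≥0∞) ≠ ⊤))).add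
    (ENNReal.Tendsto.const_mul h1 (Or.inr (by finiteness : (2 : ℝ≥0∞) ≠ ⊤)))
  simp only [mul_zero, add_zero] at hb
  exact tendsto_of_tendsto_of_tendsto_of_le_of_le tendsto_const_nhds hb (fun _ => zero_le)
    fun i => eLpNorm_trace_le (hα i)

theorem eLpNorm_sub_le_of_common_limit {X E : Type*} [MeasurableSpace X] [NormedAddCommGroup E]
    {ν : Measure X} {a b f : X → E} (ha : AEStronglyMeasurable a ν)
    (hb : AEStronglyMeasurable b ν) (hf : AEStronglyMeasurable f ν) :
    eLpNorm (fun x => a x - b x) 2 ν ≤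
      eLpNorm (fun x => a x - f x) 2 ν + eLpNorm (fun x => b x - f x) 2 ν := by
  have e : (fun x => a x - b x) = (fun x => a x - f x) - fun x => b x - f x := by
    funext x; simp
  rw [e]
  exact eLpNorm_sub_le (ha.sub hf) (hb.sub hf) one_le_two

theorem gradient_sub_of_contDiff {α β : E2 → ℝ} (hα : ContDiff ℝ ∞ α) (hβ : ContDiff ℝ ∞ β) :
    ∇ (fun x => α x - β x) = fun x => ∇ α x - ∇ β x := by
  funext x
  simp only [gradient]
  rw [← map_sub, fderiv_fun_sub (hα.differentiable (by simp) x) (hβ.differentiable (by simp) x)]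

/-- Two families that approximate the same function in `H¹` have asymptotically equal traces. Over
pairs of indices of one sequence this says that the traces form a Cauchy sequence. -/
theorem tendsto_eLpNorm_trace_sub {ι : Type*} {l : Filter ι} {α β : ι → E2 → ℝ}
    {f : E2 → ℝ} {G : E2 → E2} (hα : ∀ i, ContDiff ℝ ∞ (α i)) (hβ : ∀ i, ContDiff ℝ ∞ (β i))
    (hf : AEStronglyMeasurable f (volume.restrict disc))
    (hG : AEStronglyMeasurable G (volume.restrict disc))
    (hα0 : Tendsto (fun i => eLpNorm (fun x => α i x - f x) 2 (volume.restrict disc)) l (𝓝 0))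
    (hα1 : Tendsto (fun i => eLpNorm (fun x => ∇ (α i) x - G x) 2 (volume.restrict disc)) l (𝓝 0))
    (hβ0 : Tendsto (fun i => eLpNorm (fun x => β i x - f x) 2 (volume.restrict disc)) l (𝓝 0))
    (hβ1 : Tendsto (fun i => eLpNorm (fun x => ∇ (β i) x - G x) 2 (volume.restrict disc))
      l (𝓝 0)) :
    Tendsto (fun i => eLpNorm (fun y : ℝ => α i !₂[0, y] - β i !₂[0, y]) 2
      (volume.restrict (Ioo (-1 : ℝ) 1))) l (𝓝 0) := by
  have s0 := hα0.add hβ0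
  have s1 := hα1.add hβ1
  rw [add_zero] at s0 s1
  refine tendsto_eLpNorm_trace (α := fun i x => α i x - β i x) (fun i => (hα i).sub (hβ i)) ?_ ?_
  · exact tendsto_of_tendsto_of_tendsto_of_le_of_le tendsto_const_nhds s0 (fun _ => zero_le)
      fun i => eLpNorm_sub_le_of_common_limit (hα i).continuous.aestronglyMeasurable
        (hβ i).continuous.aestronglyMeasurable hf
  · refine tendsto_of_tendsto_of_tendsto_of_le_of_le tendsto_const_nhds s1 (fun _ => zero_le)
      fun i => ?_
    simp only [gradient_sub_of_contDiff (hα i) (hβ i)]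
    exact eLpNorm_sub_le_of_common_limit (continuous_gradient (hα i)).aestronglyMeasurable
        (continuous_gradient (hβ i)).aestronglyMeasurable hG

theorem memLp_trace {α : E2 → ℝ} (hα : ContDiff ℝ ∞ α) :
    MemLp (fun y : ℝ => α !₂[0, y]) 2 (volume.restrict (Ioo (-1 : ℝ) 1)) := by
  have hc : Continuous fun y : ℝ => α !₂[0, y] :=
    (hα.comp (contDiff_vec2 contDiff_const contDiff_id)).continuous
  exact memLp_restrict_of_continuous isCompact_Icc Ioo_subset_Icc_self measurableSet_Icc hc
    hc.aestronglyMeasurable 2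

theorem SmoothApprox.exists_trace {α : ℕ → E2 → ℝ} {f : E2 → ℝ} {G : E2 → E2}
    (h : SmoothApprox α f G) (hf : AEStronglyMeasurable f (volume.restrict disc))
    (hG : AEStronglyMeasurable G (volume.restrict disc)) :
    ∃ g : ℝ → ℝ, MemLp g 2 (volume.restrict (Ioo (-1 : ℝ) 1)) ∧
      Tendsto (fun n => eLpNorm (fun y : ℝ => α n !₂[0, y] - g y) 2
        (volume.restrict (Ioo (-1 : ℝ) 1))) atTop (𝓝 0) := by
  set a : ℕ → Lp ℝ 2 (volume.restrict (Ioo (-1 : ℝ) 1)) :=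
    fun n => (memLp_trace (h.contDiff n)).toLp with ha
  have t1 : Tendsto (Prod.fst : ℕ × ℕ → ℕ) atTop atTop := by
    rw [← prod_atTop_atTop_eq]
    exact tendsto_fst
  have t2 : Tendsto (Prod.snd : ℕ × ℕ → ℕ) atTop atTop := by
    rw [← prod_atTop_atTop_eq]
    exact tendsto_snd
  have hc : CauchySeq a := by
    rw [Lp.cauchySeq_Lp_iff_cauchySeq_eLpNorm]
    refine (tendsto_eLpNorm_trace_sub (α := fun i : ℕ × ℕ => α i.1) (β := fun i => α i.2)
      (fun i => h.contDiff i.1) (fun i => h.contDiff i.2) hf hG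
      (h.tendsto.comp t1) (h.tendsto_gradient.comp t1)
      (h.tendsto.comp t2) (h.tendsto_gradient.comp t2)).congr fun i => eLpNorm_congr_ae ?_
    filter_upwards [(memLp_trace (h.contDiff i.1)).coeFn_toLp,
      (memLp_trace (h.contDiff i.2)).coeFn_toLp] with y h1 h2
    simp [ha, h1, h2]
  obtain ⟨g, hg⟩ := cauchySeq_tendsto_of_complete hc
  refine ⟨g, Lp.memLp g, ((Lp.tendsto_Lp_iff_tendsto_eLpNorm' _ _).1 hg).congr fun n =>
    eLpNorm_congr_ae ?_⟩
  filter_upwards [(memLp_trace (h.contDiff n)).coeFn_toLp] with y h1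
  simp [ha, h1]

/-- The trace can be read off from any one smooth approximation, up to null sets. -/
theorem SmoothApprox.isTrace_iff {α : ℕ → E2 → ℝ} {f : E2 → ℝ} {G : E2 → E2} {g : ℝ → ℝ}
    (h : SmoothApprox α f G) (hfG : HasH1Gradient f G)
    (hg : MemLp g 2 (volume.restrict (Ioo (-1 : ℝ) 1)))
    (hαg : Tendsto (fun n => eLpNorm (fun y : ℝ => α n !₂[0, y] - g y) 2
        (volume.restrict (Ioo (-1 : ℝ) 1))) atTop (𝓝 0)) (k : ℝ → ℝ) :
    IsTrace f k ↔ k =ᵐ[volume.restrict (Ioo (-1 : ℝ) 1)] g := by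
  constructor
  · rintro ⟨hk, G', hG', β, hβ, hβ0, hβ1, hβk⟩
    -- The sequence `β` comes with its own weak gradient `G'`, which agrees with `G` a.e.
    have hβ1' : Tendsto (fun n => eLpNorm (fun x => ∇ (β n) x - G x) 2 (volume.restrict disc))
        atTop (𝓝 0) := hβ1.congr fun n => eLpNorm_congr_ae <| by
      filter_upwards [hfG.ae_eq hG'] with x hx
      rw [hx]
    have hαβ := tendsto_eLpNorm_trace_sub hβ h.contDiff hfG.1.1 hfG.2.1.1 hβ0 hβ1' h.tendsto
      h.tendsto_gradient
    have hsum := (hβk.add hαβ).add hαg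
    simp only [add_zero] at hsum
    have h0 : eLpNorm (k - g) 2 (volume.restrict (Ioo (-1 : ℝ) 1)) = 0 := by
      refine le_antisymm (ge_of_tendsto' hsum fun n => ?_) zero_le
      have mα := (memLp_trace (h.contDiff n)).1
      have mβ := (memLp_trace (hβ n)).1
      calc _ ≤ eLpNorm (fun y => k y - β n !₂[0, y]) 2 (volume.restrict (Ioo (-1 : ℝ) 1)) +
            eLpNorm (fun y => g y - β n !₂[0, y]) 2 (volume.restrict (Ioo (-1 : ℝ) 1)) :=
            eLpNorm_sub_le_of_common_limit hk.1 hg.1 mβ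
        _ ≤ eLpNorm (fun y => k y - β n !₂[0, y]) 2 (volume.restrict (Ioo (-1 : ℝ) 1)) +
            (eLpNorm (fun y => g y - α n !₂[0, y]) 2 (volume.restrict (Ioo (-1 : ℝ) 1)) +
            eLpNorm (fun y => β n !₂[0, y] - α n !₂[0, y]) 2
              (volume.restrict (Ioo (-1 : ℝ) 1))) := by
            gcongr
            exact eLpNorm_sub_le_of_common_limit hg.1 mβ mα
        _ = _ := by
            rw [← eLpNorm_neg (fun y => k y - β n !₂[0, y]),
              ← eLpNorm_neg (fun y => g y - α n !₂[0, y]), add_assoc,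
              add_comm (eLpNorm (-_) _ _) (eLpNorm (fun y => β n !₂[0, y] - α n !₂[0, y]) 2 _)]
            simp only [Pi.neg_def, neg_sub]
    rw [eLpNorm_eq_zero_iff (hk.1.sub hg.1) two_ne_zero] at h0
    filter_upwards [h0] with y hy using sub_eq_zero.1 hy
  · intro hk
    refine ⟨(memLp_congr_ae hk).2 hg, G, hfG, α, h.contDiff, h.tendsto, h.tendsto_gradient,
      hαg.congr fun n => eLpNorm_congr_ae ?_⟩
    filter_upwards [hk] with y hy
    rw [hy]

end Trace

/-! ### From the measure `μ` to the discs -/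

section Charts

/-- The chart `chart1` as a linear isometry. -/
noncomputable def chart1Isometry : E2 →ₗᵢ[ℝ] E3 where
  toFun := chart1
  map_add' p q := by
    refine PiLp.ext fun i => ?_
    fin_cases i <;> simp [chart1]
  map_smul' a p := by
    refine PiLp.ext fun i => ?_
    fin_cases i <;> simp [chart1]
  norm_map' p := by
    simp [chart1, EuclideanSpace.norm_eq, Fin.sum_univ_three]

/-- The chart `chart2` as a linear isometry. -/
noncomputable def chart2Isometry : E2 →ₗᵢ[ℝ] E3 where
  toFun := chart2
  map_add' p q := by
    refine PiLp.ext fun i => ?_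
    fin_cases i <;> simp [chart2]
  map_smul' a p := by
    refine PiLp.ext fun i => ?_
    fin_cases i <;> simp [chart2]
  norm_map' p := by
    simp [chart2, EuclideanSpace.norm_eq, Fin.sum_univ_three, add_comm]

theorem sq_add_sq_lt_one_of_mem_disc {p : E2} (hp : p ∈ disc) : p 0 ^ 2 + p 1 ^ 2 < 1 := by
  rw [disc, mem_ball_zero_iff, ← sq_lt_one_iff₀ (norm_nonneg _), EuclideanSpace.norm_sq_eq] at hp
  simpa [Fin.sum_univ_two] using hp

theorem map_disc_le {c : E2 → E3} (hc : Isometry c) {S : Set E3} (hS : ∀ p ∈ disc, c p ∈ S) :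
    (volume.restrict disc).map c ≤ (Measure.euclideanHausdorffMeasure 2).restrict S := by
  refine Measure.le_iff.2 fun s hs => ?_
  have hcm : Measurable c := hc.continuous.measurable
  rw [Measure.map_apply hcm hs, Measure.restrict_apply (hcm hs), Measure.restrict_apply hs,
    ← EuclideanSpace.euclideanHausdorffMeasure_eq_volume, ← hc.euclideanHausdorffMeasure_image]
  refine measure_mono ?_
  rintro _ ⟨p, ⟨hps, hpd⟩, rfl⟩
  exact ⟨hps, hS p hpd⟩

theorem map_chart1_le : (volume.restrict disc).map chart1Isometry ≤ mu :=
  (map_disc_le (S := S1) chart1Isometry.isometry fun p hp =>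
    ⟨by simpa [chart1Isometry, chart1] using (sq_add_sq_lt_one_of_mem_disc hp).le,
      by simp [chart1Isometry, chart1]⟩).trans (Measure.le_add_right le_rfl)

theorem map_chart2_le : (volume.restrict disc).map chart2Isometry ≤ mu :=
  (map_disc_le (S := S2) chart2Isometry.isometry fun p hp =>
    ⟨by simp [chart2Isometry, chart2],
      by simpa [chart2Isometry, chart2, add_comm] using (sq_add_sq_lt_one_of_mem_disc hp).le⟩).trans
    (Measure.le_add_left le_rfl)

variable {μ : Measure E3} {c : E2 →ₗᵢ[ℝ] E3}

theorem mem_support_of_mem_disc (hμ : (volume.restrict disc).map c ≤ μ) {p : E2} (hp : p ∈ disc) :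
    c p ∈ μ.support := by
  refine Measure.support_mono hμ ((Measure.mem_support_iff_forall _).2 fun U hU => ?_)
  obtain ⟨V, hVU, hV, hpV⟩ := mem_nhds_iff.1 hU
  have hVm : MeasurableSet (c ⁻¹' V) := c.continuous.measurable hV.measurableSet
  refine lt_of_lt_of_le ?_ (measure_mono hVU)
  rw [Measure.map_apply c.continuous.measurable hV.measurableSet, Measure.restrict_apply hVm]
  exact ((hV.preimage c.continuous).inter Metric.isOpen_ball).measure_pos _ ⟨p, hpV, hp⟩

theorem inner_gradient_comp {φ : E3 → ℝ} {p : E2} (hφ : DifferentiableAt ℝ φ (c p)) (v : E2) :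
    inner ℝ (∇ φ (c p)) (c v) = fderiv ℝ (fun q => φ (c q)) p v := by
  rw [inner_gradient_left]
  have h := hφ.hasFDerivAt.comp p (c.toContinuousLinearMap.hasFDerivAt (x := p))
  exact (congrArg (fun L : E2 →L[ℝ] ℝ => L v) h.fderiv).symm

/-- The tangent space at a point of the open disc contains the plane of that disc: a test function
vanishing on the support of `μ` vanishes on the disc, so its derivative along the disc is zero.
Equality fails on the common diameter, and only this inclusion is needed. -/
theorem map_mem_tangentSpace (hμ : (volume.restrict disc).map c ≤ μ) {p : E2} (hp : p ∈ disc)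
    (v : E2) : c v ∈ tangentSpace μ (c p) := by
  rw [tangentSpace, Submodule.mem_orthogonal]
  intro ξ hξ
  induction hξ using Submodule.span_induction with
  | mem ξ h =>
    obtain ⟨w, ⟨-, -, ψ, ⟨⟨hψ, -⟩, hψ0⟩, hw⟩, rfl⟩ := h
    rw [hw _ (mem_support_of_mem_disc hμ hp), inner_gradient_comp (hψ.differentiable (by simp) _)]
    have h0 : (fun q => ψ (c q)) =ᶠ[𝓝 p] fun _ => 0 := by
      filter_upwards [Metric.isOpen_ball.mem_nhds hp] with q hq
      exact hψ0 _ (mem_support_of_mem_disc hμ hq)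
    rw [h0.fderiv_eq]
    simp
  | zero => simp
  | add x y _ _ hx hy => rw [inner_add_left, hx, hy, add_zero]
  | smul a x _ hx => rw [inner_smul_left, hx, mul_zero]

/-- The adjoint of the chart turns the tangent gradient into the planar gradient: it ignores
components orthogonal to the disc, and those along the disc survive the projection onto the
tangent space. -/
theorem adjoint_tangentGradient (hμ : (volume.restrict disc).map c ≤ μ) {φ : E3 → ℝ}
    (hφ : Differentiable ℝ φ) {p : E2} (hp : p ∈ disc) :
    ContinuousLinearMap.adjoint c.toContinuousLinearMap (tangentGradient μ φ (c p)) = ∇ (fun q => φ (c q)) p := by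
  refine ext_inner_right ℝ fun v => ?_
  rw [ContinuousLinearMap.adjoint_inner_left, tangentGradient,
    Submodule.inner_starProjection_left_eq_right, LinearIsometry.coe_toContinuousLinearMap,
    Submodule.starProjection_eq_self_iff.2 (map_mem_tangentSpace hμ hp v),
    inner_gradient_comp (hφ _), inner_gradient_left]

theorem norm_adjoint_le (x : E3) : ‖ContinuousLinearMap.adjoint c.toContinuousLinearMap x‖ ≤ ‖x‖ := by
  refine ((ContinuousLinearMap.adjoint c.toContinuousLinearMap).le_opNorm x).trans ?_
  rw [LinearIsometryEquiv.norm_map]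
  exact mul_le_of_le_one_left (norm_nonneg _) c.norm_toContinuousLinearMap_le

/-- No measurability of `F` is assumed, so that the bound applies to tangent gradients, whose
measurability would require a study of `tangentSpace`. -/
theorem eLpNorm_comp_chart_le {E : Type*} [NormedAddCommGroup E]
    (hμ : (volume.restrict disc).map c ≤ μ) (F : E3 → E) :
    eLpNorm (fun p => F (c p)) 2 (volume.restrict disc) ≤ eLpNorm F 2 μ := by
  have hc : MeasurableEmbedding c := c.isometry.isClosedEmbedding.measurableEmbedding
  refine le_trans (le_of_eq ?_) (eLpNorm_mono_measure F hμ)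
  exact (hc.eLpNorm_map_measure).symm

theorem memLp_comp_chart {E : Type*} [NormedAddCommGroup E]
    (hμ : (volume.restrict disc).map c ≤ μ) {F : E3 → E} (hF : MemLp F 2 μ) :
    MemLp (fun p => F (c p)) 2 (volume.restrict disc) :=
  (hF.mono_measure hμ).comp_of_map c.continuous.measurable.aemeasurable

/-- Test functions approximating `u` in `H¹_μ` restrict to smooth functions approximating the
restriction of `u` in `H¹` of the disc. -/
theorem smoothApprox_of_tendsto (hμ : (volume.restrict disc).map c ≤ μ) {φ : ℕ → E3 → ℝ}
    {u : E3 → ℝ} {G : E3 → E3} (hφ : ∀ n, IsTest3 (φ n))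
    (h0 : Tendsto (fun n => eLpNorm (fun x => φ n x - u x) 2 μ) atTop (𝓝 0))
    (h1 : Tendsto (fun n => eLpNorm (fun x => tangentGradient μ (φ n) x - G x) 2 μ)
      atTop (𝓝 0)) :
    SmoothApprox (fun n p => φ n (c p)) (fun p => u (c p))
      (fun p => ContinuousLinearMap.adjoint c.toContinuousLinearMap (G (c p))) where
  contDiff n := (hφ n).1.comp c.toContinuousLinearMap.contDiff
  tendsto := tendsto_of_tendsto_of_tendsto_of_le_of_le tendsto_const_nhds h0 (fun _ => zero_le)
    fun n => eLpNorm_comp_chart_le hμ fun x => φ n x - u x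
  tendsto_gradient := by
    refine tendsto_of_tendsto_of_tendsto_of_le_of_le tendsto_const_nhds h1 (fun _ => zero_le)
      fun n => le_trans (eLpNorm_mono_ae ?_)
        (eLpNorm_comp_chart_le hμ fun x => tangentGradient μ (φ n) x - G x)
    filter_upwards [ae_restrict_mem (Metric.isOpen_ball (x := (0 : E2)) (ε := 1)).measurableSet]
      with p hp
    rw [← adjoint_tangentGradient hμ ((hφ n).1.differentiable (by simp)) hp, ← map_sub]
    exact norm_adjoint_le _

theorem memLp_adjoint_comp_chart (hμ : (volume.restrict disc).map c ≤ μ) {G : E3 → E3}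
    (hG : MemLp G 2 μ) :
    MemLp (fun p => ContinuousLinearMap.adjoint c.toContinuousLinearMap (G (c p))) 2
      (volume.restrict disc) :=
  (ContinuousLinearMap.adjoint c.toContinuousLinearMap).comp_memLp' (memLp_comp_chart hμ hG)

end Charts

end TwoDiscs

/-- Every `u ∈ H¹_μ` has restrictions `u₁ ∈ H¹(S₁)` and `u₂ ∈ H¹(S₂)`; each has a trace on `Σ`,
unique as an element of `L²(Σ)`, and the two traces coincide. -/
theorem proposition3p1 (u : TwoDiscs.E3 → ℝ) (hu : TwoDiscs.MemH1mu TwoDiscs.mu u) :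
    TwoDiscs.MemH1 (TwoDiscs.restr1 u) ∧ TwoDiscs.MemH1 (TwoDiscs.restr2 u) ∧
    ∃ g : ℝ → ℝ, MemLp g 2 (volume.restrict (Ioo (-1 : ℝ) 1)) ∧
      (∀ h : ℝ → ℝ, TwoDiscs.IsTrace (TwoDiscs.restr1 u) h ↔
        h =ᵐ[volume.restrict (Ioo (-1 : ℝ) 1)] g) ∧
      (∀ h : ℝ → ℝ, TwoDiscs.IsTrace (TwoDiscs.restr2 u) h ↔
        h =ᵐ[volume.restrict (Ioo (-1 : ℝ) 1)] g) := by
  obtain ⟨hu2, G, hG, φ, hφ, h0, h1⟩ := hu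
  have a1 := TwoDiscs.smoothApprox_of_tendsto TwoDiscs.map_chart1_le hφ h0 h1
  have a2 := TwoDiscs.smoothApprox_of_tendsto TwoDiscs.map_chart2_le hφ h0 h1
  have g1 := a1.hasH1Gradient (TwoDiscs.memLp_comp_chart TwoDiscs.map_chart1_le hu2)
    (TwoDiscs.memLp_adjoint_comp_chart TwoDiscs.map_chart1_le hG)
  have g2 := a2.hasH1Gradient (TwoDiscs.memLp_comp_chart TwoDiscs.map_chart2_le hu2)
    (TwoDiscs.memLp_adjoint_comp_chart TwoDiscs.map_chart2_le hG)
  obtain ⟨g, hg, hlim⟩ := a1.exists_trace g1.1.1 g1.2.1.1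
  -- Both charts send `(0, y)` to the same point of `Σ`, so the two sequences have the same traces.
  have hchart : ∀ y : ℝ, TwoDiscs.chart1Isometry !₂[0, y] = TwoDiscs.chart2Isometry !₂[0, y] := by
    intro y
    simp [TwoDiscs.chart1Isometry, TwoDiscs.chart2Isometry, TwoDiscs.chart1, TwoDiscs.chart2]
  refine ⟨⟨_, g1⟩, ⟨_, g2⟩, g, hg, a1.isTrace_iff g1 hg hlim, a2.isTrace_iff g2 hg ?_⟩
  simpa only [hchart] using hlim
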